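/- Let $\mathcal H$ be an infinite-dimensional separable complex Hilbert space, let $C$ be a trace-class operator on $\mathcal H$ and $T$ a compact operator on $\mathcal H$, both normal. The eigenvalue sequence of a compact operator $A$ on $\mathcal H$ is the sequence of its non-zero eigenvalues, arranged with decreasing absolute values, each repeated according to its algebraic multiplicity, and filled up with zeros if there are only finitely many of them. A modified eigenvalue sequence of $A$ is obtained from the eigenvalue sequence as follows: if the range of $A$ is infinite-dimensional and $\ker A$ is finite-dimensional, put $\dim\ker A$ zeros at the beginning; if the range and the kernel of $A$ are both infinite-dimensional, mix infinitely many zeros into the sequence (at arbitrary positions, keeping all its terms); if the range of $A$ is finite-dimensional, leave the sequence unchanged. Define the $C$-numerical range of $T$ by $$W_C(T)=\{\operatorname{tr}(CU^\dagger TU)\mid U\in\mathcal B(\mathcal H)\text{ unitary}\},\qquad \operatorname{tr}(A)=\sum_i\langle b_i,Ab_i\rangle$$ for any orthonormal basis $(b_i)$ of $\mathcal H$. Then $C$ and $T$ have modified eigenvalue sequences, and for every modified eigenvalue sequence $(\gamma_n)_{n\in\mathbb N}$ of $C$ and every modified eigenvalue sequence $(\tau_n)_{n\in\mathbb N}$ of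 $T$, the series $\sum_{n}\gamma_n\tau_{\sigma(n)}$ converges absolutely for every permutation $\sigma$ of $\mathbb N$, and the $C$-spectrum of $T$, $$P_C(T)=\Big\{\sum_{n}\gamma_n\tau_{\sigma(n)}\ \Big|\ \sigma:\mathbb N\to\mathbb N\text{ a permutation}\Big\},$$ satisfies $$P_C(T)\subseteq W_C(T)\subseteq\operatorname{conv}\big(\overline{P_C(T)}\big).$$ -/

import Mathlib

open scoped InnerProductSpace

noncomputable section

namespace CNumRange

variable {H : Type*} [NormedAddCommGroup H] [InnerProductSpace ℂ H] [CompleteSpace H]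

/-- `C` is trace class: it is compact and has a Schmidt decomposition
`C = ∑ₙ sₙ ⟪fₙ, ·⟫ gₙ` (convergent in operator norm), with `(fₙ)`, `(gₙ)` orthonormal systems and
`(sₙ)` a decreasing sequence in `[0, ∞)`, whose singular numbers `sₙ` are summable.
(`rankOne ℂ g f` is the operator `x ↦ ⟪f, x⟫ g`.) -/
def IsTraceClass (C : H →L[ℂ] H) : Prop :=
  IsCompactOperator C ∧
    ∃ (s : ℕ → ℝ) (f g : ℕ → H), (∀ n, 0 ≤ s n) ∧ Antitone s ∧ Orthonormal ℂ f ∧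
      Orthonormal ℂ g ∧
      HasSum (fun n => (s n : ℂ) • InnerProductSpace.rankOne ℂ (g n) (f n)) C ∧ Summable s

/-- The index set of some fixed orthonormal basis of `H`. -/
def stdIndex (H : Type*) [NormedAddCommGroup H] [InnerProductSpace ℂ H] [CompleteSpace H] :
    Set H :=
  (exists_hilbertBasis ℂ H).choose

/-- Some fixed orthonormal basis of `H`. -/
def stdBasis (H : Type*) [NormedAddCommGroup H] [InnerProductSpace ℂ H] [CompleteSpace H] :
    HilbertBasis (stdIndex H) ℂ H :=
  (exists_hilbertBasis ℂ H).choose_spec.choose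

/-- The trace `tr(A) = ∑ᵢ ⟪bᵢ, A bᵢ⟫`. By `IsTraceClass.hasSum_trace` below, for the operators
`A = C B` with `C` trace class and `B` bounded, this series converges for every orthonormal basis
and its value does not depend on the basis. -/
def trace (A : H →L[ℂ] H) : ℂ :=
  ∑' i, ⟪stdBasis H i, A (stdBasis H i)⟫_ℂ

lemma norm_tsum_aux {ι E : Type*} [NormedAddCommGroup E] [InnerProductSpace ℂ E]
    (b : HilbertBasis ι ℂ E) (x y : E) :
    Summable (fun i => ‖⟪x, b i⟫_ℂ * ⟪b i, y⟫_ℂ‖) ∧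
      ∑' i, ‖⟪x, b i⟫_ℂ * ⟪b i, y⟫_ℂ‖ ≤ (‖x‖ ^ 2 + ‖y‖ ^ 2) / 2 := by
  have key : ∀ z : E, HasSum (fun i => ‖⟪b i, z⟫_ℂ‖ ^ 2) (‖z‖ ^ 2) := by
    intro z
    have h := Complex.hasSum_re (b.hasSum_inner_mul_inner z z)
    convert h using 1
    · funext i
      rw [← inner_conj_symm z (b i), ← Complex.normSq_eq_conj_mul_self, Complex.ofReal_re,
        Complex.normSq_eq_norm_sq]
    · rw [inner_self_eq_norm_sq_to_K]
      norm_cast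
  have h1 : Summable (fun i => ‖⟪x, b i⟫_ℂ * ⟪b i, y⟫_ℂ‖) :=
    (b.summable_inner_mul_inner x y).norm
  refine ⟨h1, ?_⟩
  refine hasSum_le (fun i => ?_) h1.hasSum (((key x).add (key y)).div_const 2)
  rw [norm_mul, norm_inner_symm x (b i)]
  nlinarith [sq_nonneg (‖⟪b i, x⟫_ℂ‖ - ‖⟪b i, y⟫_ℂ‖)]

lemma hasSum_trace_aux {C : H →L[ℂ] H} {s : ℕ → ℝ} {f g : ℕ → H} (hs0 : ∀ n, 0 ≤ s n)
    (hf : Orthonormal ℂ f) (hg : Orthonormal ℂ g)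
    (hsum : HasSum (fun n => (s n : ℂ) • InnerProductSpace.rankOne ℂ (g n) (f n)) C)
    (hs : Summable s) (B : H →L[ℂ] H) {κ : Type*} (c : HilbertBasis κ ℂ H) :
    HasSum (fun i => ⟪c i, (C * B) (c i)⟫_ℂ)
      (∑' n, (s n : ℂ) * ⟪ContinuousLinearMap.adjoint B (f n), g n⟫_ℂ) := by
  set f' : ℕ → H := fun n => ContinuousLinearMap.adjoint B (f n) with hf'
  have hf'n : ∀ n, ‖f' n‖ ≤ ‖B‖ := fun n => by
    have := (ContinuousLinearMap.adjoint B).le_opNorm (f n)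
    rwa [hf.1 n, mul_one, LinearIsometryEquiv.norm_map] at this
  let F : ℕ × κ → ℂ := fun p => (s p.1 : ℂ) * (⟪f' p.1, c p.2⟫_ℂ * ⟪c p.2, g p.1⟫_ℂ)
  have hFn : ∀ n i, ‖F (n, i)‖ = s n * ‖⟪f' n, c i⟫_ℂ * ⟪c i, g n⟫_ℂ‖ := fun n i => by
    simp only [F]
    rw [norm_mul, Complex.norm_real, Real.norm_of_nonneg (hs0 n)]
  have hF : Summable F := by
    apply Summable.of_norm
    refine (summable_prod_of_nonneg (fun _ => norm_nonneg _)).2 ⟨fun n => ?_, ?_⟩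
    · simp only [hFn]
      exact (norm_tsum_aux c _ _).1.mul_left _
    · simp only [hFn, tsum_mul_left]
      refine Summable.of_nonneg_of_le
        (fun n => mul_nonneg (hs0 n) (tsum_nonneg fun _ => norm_nonneg _))
        (fun n => mul_le_mul_of_nonneg_left (?_ : _ ≤ (‖B‖ ^ 2 + 1) / 2) (hs0 n))
        (hs.mul_right _)
      refine (norm_tsum_aux c _ _).2.trans ?_
      have h2 := pow_le_pow_left₀ (norm_nonneg _) (hf'n n) 2
      rw [hg.1 n]
      linarith
  have h1 : ∀ n, HasSum (fun i => F (n, i)) ((s n : ℂ) * ⟪f' n, g n⟫_ℂ) := fun n =>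
    (c.hasSum_inner_mul_inner _ _).mul_left _
  have h2 : ∀ i, HasSum (fun n => F (n, i)) ⟪c i, (C * B) (c i)⟫_ℂ := fun i => by
    have h := (hsum.mapL (ContinuousLinearMap.apply ℂ H (B (c i)))).mapL (innerSL ℂ (c i))
    have e : (fun n => F (n, i)) = fun n => innerSL ℂ (c i)
        (ContinuousLinearMap.apply ℂ H (B (c i))
          ((s n : ℂ) • InnerProductSpace.rankOne ℂ (g n) (f n))) := by
      funext n
      simp [F, f', ContinuousLinearMap.adjoint_inner_left]
    rw [e]
    exact h
  have e1 := hF.hasSum.prod_fiberwise h1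
  have e2 := hF.prod_symm.hasSum.prod_fiberwise h2
  rw [e1.tsum_eq]
  convert e2 using 1
  exact ((Equiv.prodComm κ ℕ).tsum_eq F).symm

/-- The trace of `C B`, for `C` trace class and `B` bounded, may be computed in any orthonormal
basis. -/
theorem IsTraceClass.hasSum_trace {C : H →L[ℂ] H} (hC : IsTraceClass C) (B : H →L[ℂ] H)
    {ι : Type*} (b : HilbertBasis ι ℂ H) :
    HasSum (fun i => ⟪b i, (C * B) (b i)⟫_ℂ) (trace (C * B)) := by
  obtain ⟨-, s, f, g, hs0, -, hf, hg, hsum, hs⟩ := hC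
  have h := hasSum_trace_aux hs0 hf hg hsum hs B b
  rwa [← (hasSum_trace_aux hs0 hf hg hsum hs B (stdBasis H)).tsum_eq] at h

/-- The `C`-numerical range `W_C(T) = {tr(C U† T U) | U unitary}`. -/
def cNumericalRange (C T : H →L[ℂ] H) : Set ℂ :=
  {z | ∃ U ∈ unitary (H →L[ℂ] H), z = trace (C * (star U * T * U))}

/-- The algebraic multiplicity of `μ` for `T`: the dimension of the generalized eigenspace
`⋃ₙ ker (T - μ)ⁿ`, in `ℕ∞`. It is positive exactly at the eigenvalues of `T`. -/
def algMultiplicity (T : H →L[ℂ] H) (μ : ℂ) : ℕ∞ :=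
  Cardinal.toENat (Module.rank ℂ (Module.End.maxGenEigenspace (T : H →ₗ[ℂ] H) μ))

/-- `l` is an eigenvalue sequence of the compact operator `T`: the nonzero eigenvalues arranged
with decreasing absolute values, each repeated according to its algebraic multiplicity, filled up
with zeros if there are only finitely many. (As `‖l n‖` decreases, `l` contains a zero only if it
is eventually zero, that is, if it has only finitely many nonzero terms.) -/
def IsEigenvalueSeq (T : H →L[ℂ] H) (l : ℕ → ℂ) : Prop :=
  Antitone (fun n => ‖l n‖) ∧ ∀ μ : ℂ, μ ≠ 0 → {n | l n = μ}.encard = algMultiplicity T μ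

/-- `t` is a modified eigenvalue sequence of the compact operator `T`:
* if the range of `T` is finite-dimensional, it is an eigenvalue sequence;
* if the range is infinite-dimensional and the kernel finite-dimensional, it is an eigenvalue
  sequence preceded by `dim (ker T)` zeros;
* if both are infinite-dimensional, it is an eigenvalue sequence into which infinitely many zeros
  are mixed (`φ` gives the positions of the terms of the original sequence). -/
def IsModifiedEigenvalueSeq (T : H →L[ℂ] H) (t : ℕ → ℂ) : Prop :=
  ∃ l : ℕ → ℂ, IsEigenvalueSeq T l ∧
    (FiniteDimensional ℂ (LinearMap.range (T : H →ₗ[ℂ] H)) → t = l) ∧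
    (¬ FiniteDimensional ℂ (LinearMap.range (T : H →ₗ[ℂ] H)) →
      FiniteDimensional ℂ (LinearMap.ker (T : H →ₗ[ℂ] H)) →
        (∀ n < Module.finrank ℂ (LinearMap.ker (T : H →ₗ[ℂ] H)), t n = 0) ∧
        ∀ n, t (Module.finrank ℂ (LinearMap.ker (T : H →ₗ[ℂ] H)) + n) = l n) ∧
    (¬ FiniteDimensional ℂ (LinearMap.range (T : H →ₗ[ℂ] H)) →
      ¬ FiniteDimensional ℂ (LinearMap.ker (T : H →ₗ[ℂ] H)) →
        ∃ φ : ℕ → ℕ, StrictMono φ ∧ (Set.range φ)ᶜ.Infinite ∧ (∀ n, t (φ n) = l n) ∧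
          ∀ m ∉ Set.range φ, t m = 0)

/-- The set `{∑ₙ γₙ τ_{σ(n)} | σ a permutation of ℕ}`. It is the `C`-spectrum `P_C(T)` if `γ` and
`τ` are modified eigenvalue sequences of `C` and `T`. -/
def cSpectrum (γ τ : ℕ → ℂ) : Set ℂ :=
  {z | ∃ σ : Equiv.Perm ℕ, z = ∑' n, γ n * τ (σ n)}

end CNumRange

end

/-! Both operators are diagonal in orthonormal eigenbases. The zeros prescribed for a modified
eigenvalue sequence make every complex number, 0 included, occur in it as often as along any
eigenbasis indexed by ℕ (`IsModifiedEigenvalueSeq.encard_eq`). Sequences with equal counts differ by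
a permutation, so one may fix C bₙ = γₙ bₙ and T cₙ = τₙ cₙ with the given γ and τ. Here γ is
summable because C is trace class, and τ tends to 0 because T is compact.

A unitary sending bₙ to c_{σ(n)} realises ∑ γₙ τ_{σ(n)}, which is the first inclusion. Conversely,
tr(C U†TU) = ∑ₙ γₙ ∑ₘ τₘ |⟪cₘ, U bₙ⟫|², and these weights are doubly stochastic by Parseval. An
approximate Birkhoff theorem (`tsum_mem_closure_convexHull_cSpectrum`) then applies: an N × N corner
of the weights sits inside a 2N × 2N doubly stochastic matrix, a convex combination of permutation
matrices, whose permutations extend to ℕ by the identity. The truncation errors vanish as N grows.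

This yields a point of the closure of conv P. As P is bounded in a finite-dimensional space, the
convex hull of its closure is compact, so it contains that closure. -/

noncomputable section

namespace CNumRange

variable {H : Type*} [NormedAddCommGroup H] [InnerProductSpace ℂ H] [CompleteSpace H]

/-! ### Spectral theorem for compact normal operators -/

/-- Eigenvectors of a normal operator are eigenvectors of its adjoint. -/
lemma adjoint_apply_of_apply_eq_smul {T : H →L[ℂ] H} (hT : IsStarNormal T) {μ : ℂ} {x : H}
    (hx : T x = μ • x) : ContinuousLinearMap.adjoint T x = star μ • x := by
  -- A normal operator and its adjoint have the same kernel; this is applied to T - μ.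
  have hn : IsStarNormal (T - μ • (1 : H →L[ℂ] H)) := by
    have := hT.star_comm_self.eq
    refine ⟨?_⟩
    simp only [Commute, SemiconjBy, star_sub, star_smul, star_one, sub_mul, mul_sub, this,
      smul_mul_assoc, mul_smul_comm, one_mul, mul_one, smul_sub]
    rw [smul_comm]
    abel
  have h := (ContinuousLinearMap.IsStarNormal.adjoint_apply_eq_zero_iff hn x).2 (by simp [hx])
  rw [← ContinuousLinearMap.star_eq_adjoint] at h ⊢
  simpa [star_sub, star_smul, sub_eq_zero] using h

lemma inner_eq_zero_of_apply_eq_smul {T : H →L[ℂ] H} (hT : IsStarNormal T) {μ ν : ℂ} {x y : H}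
    (hx : T x = μ • x) (hy : T y = ν • y) (hne : μ ≠ ν) : ⟪x, y⟫_ℂ = 0 := by
  have h := ContinuousLinearMap.adjoint_inner_left T y x
  rw [adjoint_apply_of_apply_eq_smul hT hx, hy, inner_smul_left, inner_smul_right] at h
  simp only [RCLike.star_def, RingHomCompTriple.comp_apply, RingHom.id_apply] at h
  have h2 : (μ - ν) * ⟪x, y⟫_ℂ = 0 := by rw [sub_mul, h, sub_self]
  exact (mul_eq_zero.1 h2).resolve_left (sub_ne_zero.2 hne)

/-- A nonzero compact normal operator has a nonzero eigenvalue. -/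
lemma exists_apply_eq_smul_of_ne_zero {S : H →L[ℂ] H} (hS : IsCompactOperator S)
    (hSn : IsStarNormal S) (h0 : S ≠ 0) : ∃ μ : ℂ, μ ≠ 0 ∧ ∃ x : H, x ≠ 0 ∧ S x = μ • x := by
  have : Nontrivial H := by
    obtain ⟨x, hx⟩ := DFunLike.ne_iff.1 h0
    exact ⟨x, 0, fun h => hx (by simp [h])⟩
  -- For a normal operator the spectral radius is the norm, so a spectral value of maximal modulus
  -- is nonzero, hence an eigenvalue by compactness.
  obtain ⟨μ, hμ, hμr⟩ := spectrum.exists_nnnorm_eq_spectralRadius S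
  rw [IsStarNormal.spectralRadius_eq_nnnorm, ENNReal.coe_inj] at hμr
  have hμ0 : μ ≠ 0 := by
    rintro rfl
    exact h0 (by simpa using hμr.symm)
  obtain ⟨x, hx⟩ := ((hS.hasEigenvalue_iff_mem_spectrum hμ0).2 hμ).exists_hasEigenvector
  exact ⟨μ, hμ0, x, hx.2, hx.apply_eq_smul⟩

/-- The orthogonal complement of all eigenvectors is invariant under T and its adjoint, so T
composed with the projection P onto it is again compact and normal. A nonzero eigenvalue of T P
would give an eigenvector of T orthogonal to itself, so T P = 0. The complement then lies in the
kernel and is orthogonal to itself. -/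
lemma eq_zero_of_orthogonal_eigenvectors {T : H →L[ℂ] H} (hTc : IsCompactOperator T)
    (hT : IsStarNormal T) {x : H} (hx : ∀ μ : ℂ, ∀ y, T y = μ • y → ⟪y, x⟫_ℂ = 0) : x = 0 := by
  let E : Submodule ℂ H := Submodule.span ℂ {y | ∃ μ : ℂ, T y = μ • y}
  have memW : ∀ z, z ∈ Eᗮ ↔ ∀ μ : ℂ, ∀ y, T y = μ • y → ⟪y, z⟫_ℂ = 0 := fun z => by
    rw [Submodule.mem_orthogonal]
    constructor
    · exact fun h μ y hy => h y (Submodule.subset_span ⟨μ, hy⟩)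
    · intro h u hu
      refine Submodule.span_induction ?_ ?_ ?_ ?_ hu
      · rintro y ⟨μ, hy⟩
        exact h μ y hy
      · simp
      · intro a b _ _ ha hb
        rw [inner_add_left, ha, hb, add_zero]
      · intro c a _ ha
        rw [inner_smul_left, ha, mul_zero]
  have hTW : ∀ z ∈ Eᗮ, T z ∈ Eᗮ := fun z hz => (memW _).2 fun μ y hy => by
    rw [← ContinuousLinearMap.adjoint_inner_left, adjoint_apply_of_apply_eq_smul hT hy,
      inner_smul_left, (memW z).1 hz μ y hy, mul_zero]
  have hT'W : ∀ z ∈ Eᗮ, ContinuousLinearMap.adjoint T z ∈ Eᗮ := fun z hz =>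
    (memW _).2 fun μ y hy => by
      rw [ContinuousLinearMap.adjoint_inner_right, hy, inner_smul_left, (memW z).1 hz μ y hy,
        mul_zero]
  set P : H →L[ℂ] H := Eᗮ.starProjection with hP
  have hPs : star P = P := (isSelfAdjoint_starProjection Eᗮ).star_eq
  have hPP : P * P = P := (Submodule.isIdempotentElem_starProjection Eᗮ).eq
  have hcomm : P * T = T * P := by
    ext z
    have h1 : P (T (P z)) = T (P z) :=
      Submodule.starProjection_eq_self_iff.2 (hTW _ (Submodule.starProjection_apply_mem _ _))
    have h2 : P (T (z - P z)) = 0 := by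
      refine (Submodule.starProjection_apply_eq_zero_iff _).2 ?_
      rw [Submodule.mem_orthogonal]
      intro u hu
      rw [← ContinuousLinearMap.adjoint_inner_left]
      exact Submodule.inner_right_of_mem_orthogonal (hT'W u hu)
        (Submodule.sub_starProjection_mem_orthogonal z)
    rw [map_sub, map_sub, h1, sub_eq_zero] at h2
    exact h2
  have hcomm' : P * star T = star T * P := by
    have := congrArg star hcomm
    rw [star_mul, star_mul, hPs] at this
    exact this.symm
  have hSn : IsStarNormal (T * P) := by
    refine ⟨?_⟩
    have h := hT.star_comm_self.eq
    rw [Commute, SemiconjBy, star_mul, hPs]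
    calc P * star T * (T * P) = star T * (P * T) * P := by rw [hcomm']; simp only [mul_assoc]
      _ = (star T * T) * P * P := by rw [hcomm]; simp only [mul_assoc]
      _ = T * (star T * P) * P := by rw [h]; simp only [mul_assoc]
      _ = T * P * (P * star T) := by
        rw [mul_assoc T P, ← mul_assoc P P, hPP, hcomm', mul_assoc T, mul_assoc (star T), hPP]
  have hS0 : T * P = 0 := by
    by_contra h0
    obtain ⟨μ, hμ, y, hy0, hy⟩ := exists_apply_eq_smul_of_ne_zero (hTc.comp_clm P) hSn h0
    have hyW : y ∈ Eᗮ := by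
      have h1 : (T * P) y ∈ Eᗮ := hTW _ (Submodule.starProjection_apply_mem _ _)
      have h2 : y = μ⁻¹ • (T * P) y := by
        have : (T * P) y = μ • y := hy
        rw [this, smul_smul, inv_mul_cancel₀ hμ, one_smul]
      rw [h2]
      exact Submodule.smul_mem _ _ h1
    have hPy : P y = y := Submodule.starProjection_eq_self_iff.2 hyW
    have hTy : T y = μ • y := by
      rw [← hy]
      exact congrArg T hPy.symm
    exact hy0 (inner_self_eq_zero.1 ((memW y).1 hyW μ y hTy))
  have hxW := (memW x).2 hx
  have hTx : T x = (0 : ℂ) • x := by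
    have h1 : (T * P) x = 0 := by rw [hS0]; rfl
    have h2 : P x = x := Submodule.starProjection_eq_self_iff.2 hxW
    have h3 : T (P x) = 0 := h1
    rw [← h2, h3, zero_smul]
  exact inner_self_eq_zero.1 (hx 0 x hTx)

/-- **Spectral theorem**: a compact normal operator has an orthonormal basis of eigenvectors. -/
theorem exists_hilbertBasis_eigenvectors.{u} {H : Type u} [NormedAddCommGroup H]
    [InnerProductSpace ℂ H] [CompleteSpace H] {T : H →L[ℂ] H} (hTc : IsCompactOperator T)
    (hT : IsStarNormal T) :
    ∃ (ι : Type u) (b : HilbertBasis ι ℂ H) (l : ι → ℂ), ∀ i, T (b i) = l i • b i := by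
  obtain ⟨V, memV⟩ : ∃ V : ℂ → Submodule ℂ H, ∀ μ x, x ∈ V μ ↔ T x = μ • x :=
    ⟨fun μ => Module.End.eigenspace (T : H →ₗ[ℂ] H) μ, fun μ x => Module.End.mem_eigenspace_iff⟩
  have : ∀ μ, CompleteSpace (V μ) := fun μ => by
    have hc : IsClosed (V μ : Set H) := by
      have : (V μ : Set H) = {x | T x = μ • x} := Set.ext fun x => memV μ x
      rw [this]
      exact isClosed_eq (by fun_prop) (by fun_prop)
    exact hc.completeSpace_coe
  have hV : OrthogonalFamily ℂ (fun μ => V μ) fun μ => (V μ).subtypeₗᵢ := fun μ ν hne x y =>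
    inner_eq_zero_of_apply_eq_smul hT ((memV _ _).1 x.2) ((memV _ _).1 y.2) hne
  choose w c hc using fun μ => exists_hilbertBasis ℂ (V μ)
  obtain ⟨v, hv⟩ : ∃ v : (Σ μ, w μ) → H, v = fun a => (V a.1).subtypeₗᵢ (c a.1 a.2) := ⟨_, rfl⟩
  have ho : Orthonormal ℂ v := by
    rw [hv]
    exact hV.orthonormal_sigma_orthonormal (fun μ => (c μ).orthonormal)
  -- A vector orthogonal to the glued bases is orthogonal to every eigenvector, by expanding the
  -- latter in the basis of its own eigenspace.
  have hbot : (Submodule.span ℂ (Set.range v))ᗮ = ⊥ := by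
    rw [Submodule.eq_bot_iff]
    intro x hx
    refine eq_zero_of_orthogonal_eigenvectors hTc hT fun μ y hy => ?_
    have hs := ((c μ).hasSum_repr ⟨y, (memV μ y).2 hy⟩).mapL (V μ).subtypeL
    have hs2 := hs.mapL (innerSL ℂ x)
    have hz : ∀ i, innerSL ℂ x ((V μ).subtypeL
        (((c μ).repr ⟨y, (memV μ y).2 hy⟩) i • c μ i)) = 0 := fun i => by
      have := Submodule.inner_left_of_mem_orthogonal
        (Submodule.subset_span (Set.mem_range_self (⟨μ, i⟩ : Σ μ, w μ))) hx
      rw [hv] at this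
      simp only [map_smul, innerSL_apply_apply, smul_eq_mul]
      exact mul_eq_zero_of_right _ this
    simp only [hz] at hs2
    have := hs2.unique hasSum_zero
    rw [← inner_conj_symm]
    simp only [Submodule.subtypeL_apply, innerSL_apply_apply] at this
    rw [this, map_zero]
  refine ⟨_, HilbertBasis.mkOfOrthogonalEqBot ho hbot, fun a => a.1, fun a => ?_⟩
  rw [HilbertBasis.coe_mkOfOrthogonalEqBot, hv]
  exact (memV _ _).1 (c a.1 a.2).2

/-! ### Orthonormal families: countability, decay of eigenvalues, dimension counts -/

omit [CompleteSpace H] in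
lemma norm_sub_sq_of_orthonormal {ι : Type*} {b : ι → H} (hb : Orthonormal ℂ b) {i j : ι}
    (hij : i ≠ j) (α β : ℂ) : ‖α • b i - β • b j‖ ^ 2 = ‖α‖ ^ 2 + ‖β‖ ^ 2 := by
  have h0 : ⟪α • b i, β • b j⟫_ℂ = 0 := by
    rw [inner_smul_left, inner_smul_right, hb.2 hij, mul_zero, mul_zero]
  rw [@norm_sub_sq ℂ, h0, norm_smul, norm_smul, hb.1, hb.1]
  simp

omit [CompleteSpace H] in
/-- Orthonormal families in a separable space are countable. -/
lemma countable_of_orthonormal [TopologicalSpace.SeparableSpace H] {ι : Type*} {b : ι → H}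
    (hb : Orthonormal ℂ b) : Countable ι := by
  refine Pairwise.countable_of_isOpen_disjoint (s := fun i => Metric.ball (b i) (1 / 2)) ?_
    (fun _ => Metric.isOpen_ball) fun i => ⟨b i, Metric.mem_ball_self (by norm_num)⟩
  intro i j hij
  refine Metric.ball_disjoint_ball ?_
  have h := norm_sub_sq_of_orthonormal hb hij 1 1
  rw [one_smul, one_smul, norm_one] at h
  rw [dist_eq_norm]
  nlinarith [norm_nonneg (b i - b j)]

omit [CompleteSpace H] in
/-- The eigenvalues of a compact operator along an orthonormal family tend to zero. -/
lemma finite_setOf_le_norm_eigenvalue {T : H →L[ℂ] H} (hTc : IsCompactOperator T) {ι : Type*}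
    {b : ι → H} (hb : Orthonormal ℂ b) {l : ι → ℂ} (hl : ∀ i, T (b i) = l i • b i) {ε : ℝ}
    (hε : 0 < ε) : {i | ε ≤ ‖l i‖}.Finite := by
  obtain ⟨K, hK, hKT⟩ := hTc.image_closedBall_subset_compact (𝕜₁ := ℂ) (𝕜₂ := ℂ) 1
  -- Points in a common ε/2-ball are less than ε apart, while orthogonal vectors of norm at least ε
  -- are at distance at least √2 ε. So each ball serves at most one such index.
  obtain ⟨t, ht, hcov⟩ := Metric.totallyBounded_iff.1 hK.totallyBounded (ε / 2) (by positivity)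
  have hmem : ∀ i, ∃ y ∈ t, l i • b i ∈ Metric.ball y (ε / 2) := fun i => by
    have : l i • b i ∈ K := hKT ⟨b i, by simp [hb.1], hl i⟩
    simpa using hcov this
  choose y hyt hy using hmem
  refine Set.Finite.of_finite_image (f := y) (ht.subset ?_) ?_
  · rintro _ ⟨i, -, rfl⟩
    exact hyt i
  · intro i hi j hj hij
    by_contra hne
    have h := norm_sub_sq_of_orthonormal hb hne (l i) (l j)
    have h1 := Metric.mem_ball.1 (hy i)
    have h2 := Metric.mem_ball.1 (hy j)
    have hij' : y i = y j := hij
    rw [← hij'] at h2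
    have h3 := dist_triangle_right (l i • b i) (l j • b j) (y i)
    rw [dist_eq_norm] at h3
    have hi' : ε ≤ ‖l i‖ := hi
    nlinarith [norm_nonneg (l i • b i - l j • b j), norm_nonneg (l j)]

lemma exists_hilbertBasis_reindex {ι κ : Type*} (b : HilbertBasis ι ℂ H) (e : κ ≃ ι) :
    ∃ c : HilbertBasis κ ℂ H, ∀ k, c k = b (e k) := by
  refine ⟨HilbertBasis.mk (b.orthonormal.comp e e.injective) ?_, fun k => ?_⟩
  · rw [e.surjective.range_comp, b.dense_span]
  · rw [HilbertBasis.coe_mk]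
    rfl

omit [CompleteSpace H] in
lemma mem_span_of_inner_eq_zero {ι : Type*} (b : HilbertBasis ι ℂ H) {S : Set ι} (hS : S.Finite)
    {x : H} (hx : ∀ i ∉ S, ⟪b i, x⟫_ℂ = 0) : x ∈ Submodule.span ℂ (b '' S) := by
  have h1 : HasSum (fun i => b.repr x i • b i) (∑ i ∈ hS.toFinset, b.repr x i • b i) :=
    hasSum_sum_of_ne_finset_zero fun i hi => by
      rw [b.repr_apply_apply, hx i (by simpa using hi), zero_smul]
  rw [(b.hasSum_repr x).unique h1]
  refine Submodule.sum_mem _ fun i hi => Submodule.smul_mem _ _ (Submodule.subset_span ?_)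
  exact ⟨i, by simpa using hi, rfl⟩

omit [CompleteSpace H] in
lemma eq_zero_of_forall_inner_eq_zero {ι : Type*} (b : HilbertBasis ι ℂ H) {x : H}
    (hx : ∀ i, ⟪b i, x⟫_ℂ = 0) : x = 0 := by
  simpa using mem_span_of_inner_eq_zero b Set.finite_empty fun i _ => hx i

omit [CompleteSpace H] in
/-- The dimension of the space of vectors supported on `S` is the number of elements of `S`. -/
lemma toENat_rank_eq_encard {ι : Type*} (b : HilbertBasis ι ℂ H) {S : Set ι} {G : Submodule ℂ H}
    (hG : ∀ x, x ∈ G ↔ ∀ i ∉ S, ⟪b i, x⟫_ℂ = 0) :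
    Cardinal.toENat (Module.rank ℂ G) = S.encard := by
  have hS := toENat_rank_span_set (b.orthonormal.linearIndependent.linearIndepOn (s := S))
  have hle : Submodule.span ℂ (b '' S) ≤ G := by
    rw [Submodule.span_le]
    rintro _ ⟨i, hi, rfl⟩
    refine (hG _).2 fun j hj => b.orthonormal.2 fun h => hj (h ▸ hi)
  rcases S.finite_or_infinite with hf | hinf
  · rw [← hS, le_antisymm hle fun x hx => mem_span_of_inner_eq_zero b hf ((hG x).1 hx)]
  · rw [hinf.encard_eq] at hS ⊢
    rw [← top_le_iff, ← hS]
    exact OrderHomClass.mono Cardinal.toENat (Submodule.rank_mono hle)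

/-! ### Multiplicities, kernel and range read off the diagonal -/

section Diagonal

variable {T : H →L[ℂ] H} {ι : Type*} {b : HilbertBasis ι ℂ H} {l : ι → ℂ}

lemma inner_apply_eigenvector (hT : IsStarNormal T) (hl : ∀ i, T (b i) = l i • b i) (i : ι)
    (x : H) : ⟪b i, T x⟫_ℂ = l i * ⟪b i, x⟫_ℂ := by
  rw [← ContinuousLinearMap.adjoint_inner_left, adjoint_apply_of_apply_eq_smul hT (hl i),
    inner_smul_left]
  simp

/-- The algebraic multiplicity of `μ` is the number of occurrences of `μ` in the diagonal. -/
lemma encard_eq_algMultiplicity (hT : IsStarNormal T) (hl : ∀ i, T (b i) = l i • b i) (μ : ℂ) :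
    {i | l i = μ}.encard = algMultiplicity T μ := by
  refine (toENat_rank_eq_encard b fun x => ?_).symm
  -- (T - μ)ᵏ is diagonal with entries (l i - μ)ᵏ, so generalized eigenvectors are already
  -- eigenvectors.
  have hpow : ∀ k i, ⟪b i, (((T : H →ₗ[ℂ] H) - μ • 1) ^ k) x⟫_ℂ = (l i - μ) ^ k * ⟪b i, x⟫_ℂ := by
    intro k i
    induction k with
    | zero => simp
    | succ k ih =>
      rw [pow_succ', Module.End.mul_apply, LinearMap.sub_apply, LinearMap.smul_apply,
        Module.End.one_apply, ContinuousLinearMap.coe_coe, inner_sub_right, inner_smul_right,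
        inner_apply_eigenvector hT hl, ih]
      ring
  rw [Module.End.mem_maxGenEigenspace]
  constructor
  · rintro ⟨k, hk⟩ i hi
    have := hpow k i
    rw [hk, inner_zero_right, eq_comm, mul_eq_zero] at this
    exact this.resolve_left (pow_ne_zero _ (sub_ne_zero.2 hi))
  · intro h
    refine ⟨1, eq_zero_of_forall_inner_eq_zero b fun i => ?_⟩
    rw [hpow, pow_one]
    by_cases hi : l i = μ
    · rw [hi, sub_self, zero_mul]
    · rw [h i hi, mul_zero]

lemma toENat_rank_ker (hT : IsStarNormal T) (hl : ∀ i, T (b i) = l i • b i) :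
    Cardinal.toENat (Module.rank ℂ (LinearMap.ker (T : H →ₗ[ℂ] H))) = {i | l i = 0}.encard := by
  refine toENat_rank_eq_encard b fun x => ?_
  rw [LinearMap.mem_ker, ContinuousLinearMap.coe_coe]
  constructor
  · intro h i hi
    have := inner_apply_eigenvector hT hl i x
    rw [h, inner_zero_right, eq_comm, mul_eq_zero] at this
    exact this.resolve_left hi
  · intro h
    refine eq_zero_of_forall_inner_eq_zero b fun i => ?_
    rw [inner_apply_eigenvector hT hl, mul_eq_zero]
    exact or_iff_not_imp_left.2 fun hi => h i hi

lemma finiteDimensional_range_iff (hT : IsStarNormal T) (hl : ∀ i, T (b i) = l i • b i) :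
    FiniteDimensional ℂ (LinearMap.range (T : H →ₗ[ℂ] H)) ↔ {i | l i ≠ 0}.Finite := by
  constructor
  · intro h
    have hS := toENat_rank_span_set
      (b.orthonormal.linearIndependent.linearIndepOn (s := {i | l i ≠ 0}))
    have hle : Submodule.span ℂ (b '' {i | l i ≠ 0}) ≤ LinearMap.range (T : H →ₗ[ℂ] H) := by
      rw [Submodule.span_le]
      rintro _ ⟨i, hi, rfl⟩
      exact ⟨(l i)⁻¹ • b i, by simp [hl, smul_smul, inv_mul_cancel₀ (show l i ≠ 0 from hi)]⟩
    have := Submodule.finiteDimensional_of_le hle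
    rw [← Module.finrank_eq_rank, map_natCast] at hS
    exact Set.finite_of_encard_eq_coe hS.symm
  · intro h
    have : FiniteDimensional ℂ (Submodule.span ℂ (b '' {i | l i ≠ 0})) :=
      FiniteDimensional.span_of_finite ℂ (h.image _)
    refine Submodule.finiteDimensional_of_le
      (S₂ := Submodule.span ℂ (b '' {i | l i ≠ 0})) ?_
    rintro _ ⟨x, rfl⟩
    refine mem_span_of_inner_eq_zero b h fun i hi => ?_
    rw [ContinuousLinearMap.coe_coe, inner_apply_eigenvector hT hl, not_not.1 hi, zero_mul]

end Diagonal

/-! ### Ordering and counting the values of a sequence -/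

/-- An infinite countable family of reals in which each term is exceeded by finitely many others
can be arranged in decreasing order. -/
lemma exists_equiv_antitone {ι : Type*} [Countable ι] [Infinite ι] (f : ι → ℝ)
    (hf : ∀ i, {j | f i < f j}.Finite) : ∃ e : ℕ ≃ ι, Antitone (f ∘ e) := by
  classical
  obtain ⟨c⟩ := nonempty_equiv_of_countable (α := ι) (β := ℕ)
  -- The predecessors of i: larger values, with ties broken by the enumeration `c`. The relation is
  -- transitive, so the number of predecessors is an injective rank, and listing the ranks
  -- increasingly orders the family.
  let B : ι → Set ι := fun i => {j | f i < f j ∨ f i = f j ∧ c j < c i}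
  have hB : ∀ i, (B i).Finite := fun i =>
    ((hf i).union ((Set.finite_Iio (c i)).preimage c.injective.injOn)).subset fun j hj =>
      hj.imp id And.right
  have hlt : ∀ i j, j ∈ B i → (B j).ncard < (B i).ncard := by
    intro i j hij
    refine Set.ncard_lt_ncard ⟨fun k hk => ?_, fun h => ?_⟩ (hB i)
    · rcases hij with h1 | ⟨h1, h2⟩ <;> rcases hk with h3 | ⟨h3, h4⟩
      · exact Or.inl (h1.trans h3)
      · exact Or.inl (h3 ▸ h1)
      · exact Or.inl (h1 ▸ h3)
      · exact Or.inr ⟨h1.trans h3, h4.trans h2⟩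
    · rcases h hij with h1 | ⟨-, h1⟩ <;> exact lt_irrefl _ h1
  let r : ι → ℕ := fun i => (B i).ncard
  have hr : Function.Injective r := by
    intro i j hij
    by_contra hne
    rcases lt_trichotomy (f i) (f j) with h | h | h
    · exact (hlt i j (Or.inl h)).ne' hij
    · rcases (c.injective.ne hne).lt_or_gt with h' | h'
      · exact (hlt j i (Or.inr ⟨h.symm, h'⟩)).ne hij
      · exact (hlt i j (Or.inr ⟨h, h'⟩)).ne' hij
    · exact (hlt j i (Or.inl h)).ne hij
  have : Infinite (Set.range r) := Set.infinite_range_of_injective hr |>.to_subtype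
  let o := Nat.Subtype.orderIsoOfNat (Set.range r)
  let e0 := Equiv.ofInjective r hr
  have he0 : ∀ x, r (e0.symm x) = x := fun x => Equiv.apply_ofInjective_symm hr x
  refine ⟨o.toEquiv.trans e0.symm, fun m n hmn => ?_⟩
  by_contra! h
  have h1 := hlt (e0.symm (o m)) (e0.symm (o n)) (Or.inl h)
  have h2 : (o m : ℕ) ≤ o n := o.monotone hmn
  change r _ < r _ at h1
  rw [he0, he0] at h1
  exact absurd h1 (not_lt.2 h2)

lemma encard_setOf_comp_eq {ι : Type*} {l : ι → ℂ} {e : ℕ → ι} (he : Function.Injective e) {μ : ℂ}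
    (hr : {i | l i = μ} ⊆ Set.range e) : {n | l (e n) = μ}.encard = {i | l i = μ}.encard := by
  rw [← he.encard_image]
  congr 1
  ext i
  constructor
  · rintro ⟨n, hn, rfl⟩
    exact hn
  · intro hi
    obtain ⟨n, rfl⟩ := hr hi
    exact ⟨n, hi, rfl⟩

lemma finite_setOf_ne_zero_of_encard_eq {u v : ℕ → ℂ}
    (h : ∀ μ, μ ≠ 0 → {n | u n = μ}.encard = {n | v n = μ}.encard) (hv : {n | v n ≠ 0}.Finite) :
    {n | u n ≠ 0}.Finite := by
  refine ((hv.image v).biUnion (t := fun μ => {n | u n = μ}) ?_).subset fun n hn => ?_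
  · rintro _ ⟨m, hm, rfl⟩
    rw [← Set.encard_ne_top_iff, h _ hm, Set.encard_ne_top_iff]
    refine hv.subset fun k hk => ?_
    rw [Set.mem_ofPred_eq, show v k = v m from hk]
    exact hm
  · have h1 : {m | v m = u n}.Nonempty := by
      rw [← Set.encard_ne_zero, ← h _ hn, Set.encard_ne_zero]
      exact ⟨n, rfl⟩
    obtain ⟨m, hm⟩ := h1
    refine Set.mem_biUnion ⟨m, ?_, hm⟩ rfl
    rw [Set.mem_ofPred_eq, show v m = u n from hm]
    exact hn

/-! ### Modified eigenvalue sequences as diagonals -/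

section Compact

variable [TopologicalSpace.SeparableSpace H]

/-- A compact normal operator on an infinite-dimensional separable space is diagonal in an
orthonormal basis indexed by `ℕ`. -/
lemma exists_nat_hilbertBasis_eigenvectors (hH : ¬ FiniteDimensional ℂ H) {T : H →L[ℂ] H}
    (hTc : IsCompactOperator T) (hT : IsStarNormal T) :
    ∃ (b : HilbertBasis ℕ ℂ H) (l : ℕ → ℂ), ∀ i, T (b i) = l i • b i := by
  obtain ⟨ι, b, l, hl⟩ := exists_hilbertBasis_eigenvectors hTc hT
  have : Countable ι := countable_of_orthonormal b.orthonormal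
  have : Infinite ι := by
    by_contra hfin
    rw [not_infinite_iff_finite] at hfin
    have htop : Submodule.span ℂ (b '' Set.univ) = ⊤ := Submodule.eq_top_iff'.2 fun x =>
      mem_span_of_inner_eq_zero b Set.finite_univ fun i hi => absurd (Set.mem_univ i) hi
    exact hH (Module.finite_def.2
      (htop ▸ Submodule.fg_span (Set.finite_univ.image b)))
  obtain ⟨e⟩ := nonempty_equiv_of_countable (α := ℕ) (β := ι)
  obtain ⟨c, hc⟩ := exists_hilbertBasis_reindex b e
  exact ⟨c, fun n => l (e n), fun n => by rw [hc, hl]⟩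

lemma exists_isEigenvalueSeq (hH : ¬ FiniteDimensional ℂ H) {T : H →L[ℂ] H}
    (hTc : IsCompactOperator T) (hT : IsStarNormal T) : ∃ l, IsEigenvalueSeq T l := by
  obtain ⟨b, l, hl⟩ := exists_nat_hilbertBasis_eigenvectors hH hTc hT
  suffices ∃ e : ℕ → ℕ, Function.Injective e ∧ {i | l i ≠ 0} ⊆ Set.range e ∧
      Antitone fun n => ‖l (e n)‖ by
    obtain ⟨e, he, hr, ha⟩ := this
    refine ⟨fun n => l (e n), ha, fun μ hμ => ?_⟩
    rw [← encard_eq_algMultiplicity hT hl μ]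
    exact encard_setOf_comp_eq he fun i hi => hr (by rwa [Set.mem_ofPred_eq, show l i = μ from hi])
  have hfin : ∀ ε : ℝ, 0 < ε → {i | ε ≤ ‖l i‖}.Finite := fun ε hε =>
    finite_setOf_le_norm_eigenvalue hTc b.orthonormal hl hε
  -- With finitely many nonzero entries, the whole diagonal can be sorted, zeros last. Otherwise a
  -- zero would have infinitely many predecessors, so only the nonzero entries are sorted.
  rcases {i | l i ≠ 0}.finite_or_infinite with hS | hS
  · obtain ⟨e, he⟩ := exists_equiv_antitone (fun i => ‖l i‖) fun i => hS.subset fun j hj =>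
      norm_pos_iff.1 ((norm_nonneg _).trans_lt hj)
    exact ⟨e, e.injective, fun i _ => e.surjective i, he⟩
  · have := hS.to_subtype
    obtain ⟨e, he⟩ := exists_equiv_antitone (fun i : {i | l i ≠ 0} => ‖l i‖) fun i =>
      ((hfin ‖l i‖ (norm_pos_iff.2 i.2)).preimage Subtype.val_injective.injOn).subset
        fun j (hj : ‖l i‖ < ‖l j‖) => show ‖l i‖ ≤ ‖l j‖ from hj.le
    refine ⟨fun n => e n, Subtype.val_injective.comp e.injective, fun i hi => ?_, he⟩
    exact ⟨e.symm ⟨i, hi⟩, by simp⟩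

lemma exists_isModifiedEigenvalueSeq (hH : ¬ FiniteDimensional ℂ H) {T : H →L[ℂ] H}
    (hTc : IsCompactOperator T) (hT : IsStarNormal T) : ∃ t, IsModifiedEigenvalueSeq T t := by
  obtain ⟨l, hl⟩ := exists_isEigenvalueSeq hH hTc hT
  by_cases h1 : FiniteDimensional ℂ (LinearMap.range (T : H →ₗ[ℂ] H))
  · exact ⟨l, l, hl, fun _ => rfl, fun h => absurd h1 h, fun h => absurd h1 h⟩
  by_cases h2 : FiniteDimensional ℂ (LinearMap.ker (T : H →ₗ[ℂ] H))
  · set k := Module.finrank ℂ (LinearMap.ker (T : H →ₗ[ℂ] H)) with hk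
    refine ⟨fun n => if n < k then 0 else l (n - k), l, hl, fun h => absurd h h1, fun _ _ =>
      ⟨fun n hn => if_pos hn, fun n => ?_⟩, fun _ h => absurd h2 h⟩
    rw [← hk]
    simp
  -- The eigenvalues occupy the even positions and the added zeros the odd ones.
  · refine ⟨fun n => if Even n then l (n / 2) else 0, l, hl, fun h => absurd h h1,
      fun _ h => absurd h h2, fun _ _ => ⟨fun n => 2 * n, fun m n h => by simpa using h, ?_,
        fun n => by simp, fun m hm => if_neg fun ⟨r, hr⟩ => hm ⟨r, by simp [hr, two_mul]⟩⟩⟩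
    refine Set.infinite_of_injective_forall_mem (f := fun n : ℕ => 2 * n + 1)
      (fun m n h => by simpa using h) fun n => ?_
    rintro ⟨m, hm⟩
    simp only at hm
    omega

omit [TopologicalSpace.SeparableSpace H] in
/-- A modified eigenvalue sequence contains every number as often as the diagonal does. -/
lemma IsModifiedEigenvalueSeq.encard_eq {T : H →L[ℂ] H} (hT : IsStarNormal T)
    {b : HilbertBasis ℕ ℂ H} {l : ℕ → ℂ} (hl : ∀ i, T (b i) = l i • b i) {t : ℕ → ℂ}
    (ht : IsModifiedEigenvalueSeq T t) (μ : ℂ) : {n | t n = μ}.encard = {n | l n = μ}.encard := by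
  obtain ⟨s, ⟨hsa, hs⟩, h1, h2, h3⟩ := ht
  replace hs : ∀ μ : ℂ, μ ≠ 0 → {n | s n = μ}.encard = {n | l n = μ}.encard := fun μ hμ => by
    rw [hs μ hμ, encard_eq_algMultiplicity hT hl]
  have hnz : {n | s n ≠ 0}.Finite ↔ {n | l n ≠ 0}.Finite :=
     ⟨finite_setOf_ne_zero_of_encard_eq fun μ hμ => (hs μ hμ).symm,
      finite_setOf_ne_zero_of_encard_eq hs⟩
  have hrange := finiteDimensional_range_iff hT hl
  have hker := toENat_rank_ker hT hl
  by_cases hr : FiniteDimensional ℂ (LinearMap.range (T : H →ₗ[ℂ] H))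
  · rw [h1 hr]
    rcases ne_or_eq μ 0 with hμ | rfl
    · exact hs μ hμ
    · have key : ∀ u : ℕ → ℂ, {n | u n ≠ 0}.Finite → {n | u n = 0}.encard = ⊤ := fun u hu => by
        have := hu.infinite_compl
        rw [Set.encard_eq_top_iff]
        convert this using 1
        ext n
        simp
      rw [key s (hnz.2 (hrange.1 hr)), key l (hrange.1 hr)]
  -- A zero at n would force zeros from n on, hence finite rank. So every zero of t is one that the
  -- modification added.
  have hs0 : ∀ n, s n ≠ 0 := by
    intro n hn
    refine (hrange.not.1 hr) (hnz.1 ((Set.finite_Iio n).subset fun m hm => ?_))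
    by_contra hmn
    have := hsa (not_lt.1 hmn)
    simp only [hn, norm_zero, norm_le_zero_iff] at this
    exact hm this
  by_cases hk : FiniteDimensional ℂ (LinearMap.ker (T : H →ₗ[ℂ] H))
  · obtain ⟨h4, h5⟩ := h2 hr hk
    rw [← Module.finrank_eq_rank, map_natCast] at hker
    set k := Module.finrank ℂ (LinearMap.ker (T : H →ₗ[ℂ] H)) with hkdef
    rcases ne_or_eq μ 0 with hμ | rfl
    · rw [← hs μ hμ]
      simp only [← h5]
      refine (encard_setOf_comp_eq (add_right_injective k) fun n hn => ?_).symm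
      refine ⟨n - k, ?_⟩
      have : k ≤ n := not_lt.1 fun h => hμ (by rw [← show t n = μ from hn, h4 n h])
      simp [this]
    · rw [← hker]
      have : {n | t n = 0} = Set.Iio k := by
        ext n
        refine ⟨fun hn => ?_, h4 n⟩
        by_contra h
        refine hs0 (n - k) ?_
        rw [← h5, Nat.add_sub_cancel' (not_lt.1 h)]
        exact hn
      rw [this, ← Finset.coe_Iio, Set.encard_coe_eq_coe_finsetCard, Nat.card_Iio]
  · obtain ⟨φ, hφ, hφi, hφt, h0⟩ := h3 hr hk
    rcases ne_or_eq μ 0 with hμ | rfl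
    · rw [← hs μ hμ]
      simp only [← hφt]
      refine (encard_setOf_comp_eq hφ.injective fun n hn => ?_).symm
      by_contra h
      exact hμ (by rw [← show t n = μ from hn, h0 n h])
    · have htop : {n | t n = 0}.encard = ⊤ := Set.encard_eq_top_iff.2 (hφi.mono fun m hm => h0 m hm)
      rw [← hker, htop, eq_comm, Cardinal.toENat_eq_top, ← not_lt, Module.rank_lt_aleph0_iff]
      exact hk

/-- Fibres over the same value are countable of equal size, hence in bijection; gluing these
bijections gives the permutation. -/
lemma exists_perm_of_encard_eq {t l : ℕ → ℂ}
    (h : ∀ μ, {n | t n = μ}.encard = {n | l n = μ}.encard) :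
    ∃ e : Equiv.Perm ℕ, ∀ n, l (e n) = t n := by
  have hμ : ∀ μ, Nonempty ({n // t n = μ} ≃ {n // l n = μ}) := fun μ =>
    Cardinal.eq.1 (Cardinal.toENat_injOn (Cardinal.mk_le_aleph0) (Cardinal.mk_le_aleph0) (h μ))
  let e := fun μ => (hμ μ).some
  refine ⟨(Equiv.sigmaFiberEquiv t).symm.trans ((Equiv.sigmaCongrRight e).trans
    (Equiv.sigmaFiberEquiv l)), fun n => ?_⟩
  exact (e (t n) ⟨n, rfl⟩).2

/-- Every modified eigenvalue sequence of a compact normal operator is its diagonal in some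
orthonormal basis. -/
theorem IsModifiedEigenvalueSeq.exists_hilbertBasis (hH : ¬ FiniteDimensional ℂ H) {T : H →L[ℂ] H}
    (hTc : IsCompactOperator T) (hT : IsStarNormal T) {t : ℕ → ℂ}
    (ht : IsModifiedEigenvalueSeq T t) :
    ∃ b : HilbertBasis ℕ ℂ H, ∀ n, T (b n) = t n • b n := by
  obtain ⟨b, l, hl⟩ := exists_nat_hilbertBasis_eigenvectors hH hTc hT
  obtain ⟨e, he⟩ := exists_perm_of_encard_eq (ht.encard_eq hT hl)
  obtain ⟨c, hc⟩ := exists_hilbertBasis_reindex b e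
  exact ⟨c, fun n => by rw [hc, hl, he]⟩

end Compact

/-! ### Convex hulls and an approximate Birkhoff theorem -/

/-- In finite dimension, the convex hull of a compact set is compact. -/
lemma isCompact_convexHull_of_isCompact {E : Type*} [NormedAddCommGroup E] [NormedSpace ℝ E]
    [FiniteDimensional ℝ E] {K : Set E} (hK : IsCompact K) : IsCompact (convexHull ℝ K) := by
  classical
  rcases K.eq_empty_or_nonempty with rfl | ⟨k, hk⟩
  · simp
  -- By Carathéodory, dim E + 1 points suffice, so the hull is a continuous image of simplex ×
  -- K^(dim E + 1). Unused slots get weight 0 and the point k.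
  let ι := Fin (Module.finrank ℝ E + 1)
  have hcomp : IsCompact ((fun p : (ι → ℝ) × (ι → E) => ∑ i, p.1 i • p.2 i) ''
      (stdSimplex ℝ ι ×ˢ Set.univ.pi fun _ => K)) :=
    ((isCompact_stdSimplex ℝ ι).prod (isCompact_univ_pi fun _ => hK)).image (by fun_prop)
  convert hcomp using 1
  ext x
  constructor
  · intro hx
    obtain ⟨κ, _, z, w, hz, hind, hw, hw1, hx⟩ := eq_pos_convex_span_of_mem_convexHull hx
    have hcard : Fintype.card κ ≤ Fintype.card ι := by
      rw [Fintype.card_fin]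
      exact hind.card_le_finrank_succ.trans
        (Nat.succ_le_succ (Submodule.finrank_le _))
    obtain ⟨f⟩ := Function.Embedding.nonempty_of_card_le hcard
    have hz' : ∀ i, Function.extend f z (fun _ => k) i ∈ K := fun i => by
      by_cases hi : ∃ j, f j = i
      · obtain ⟨j, rfl⟩ := hi
        rw [f.injective.extend_apply]
        exact hz ⟨j, rfl⟩
      · rwa [Function.extend_apply' _ _ _ hi]
    refine ⟨(Function.extend f w 0, Function.extend f z fun _ => k),
      ⟨⟨fun i => ?_, ?_⟩, fun i _ => hz' i⟩, ?_⟩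
    · by_cases hi : ∃ j, f j = i
      · obtain ⟨j, rfl⟩ := hi
        simpa only [f.injective.extend_apply] using (hw j).le
      · simp only [Function.extend_apply' _ _ _ hi, Pi.zero_apply, le_refl]
    · rw [← hw1]
      refine (Fintype.sum_of_injective f f.injective _ _ (fun i hi => ?_) fun i => ?_).symm
      · exact Function.extend_apply' _ _ _ hi
      · exact (f.injective.extend_apply _ _ _).symm
    · rw [← hx]
      refine (Fintype.sum_of_injective f f.injective _ _ (fun i hi => ?_) fun i => ?_).symm
      · simp only
        rw [Function.extend_apply' _ _ _ hi, Pi.zero_apply, zero_smul]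
      · simp only [f.injective.extend_apply]
  · rintro ⟨⟨w, z⟩, ⟨⟨hw0, hw1⟩, hz⟩, rfl⟩
    exact mem_convexHull_of_exists_fintype w z hw0 hw1 (fun i => hz i (Set.mem_univ i)) rfl

/-- Replacing u by v in the first N terms costs at most δ ∑ ‖γₙ‖, and dropping the tail costs at
most δ B. The bound serves both the doubly stochastic average and each permutation sum. -/
lemma norm_tsum_mul_sub_sum_le {γ u : ℕ → ℂ} {B δ : ℝ} {N : ℕ} {v : Fin N → ℂ}
    (hγ : Summable γ) (hu : ∀ n, ‖u n‖ ≤ B) (hv : ∀ i : Fin N, ‖u i - v i‖ ≤ δ)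
    (htail : ∑' n, ‖γ (n + N)‖ ≤ δ) :
    ‖∑' n, γ n * u n - ∑ i : Fin N, γ i * v i‖ ≤ (∑' n, ‖γ n‖ + B) * δ := by
  have hB : 0 ≤ B := (norm_nonneg _).trans (hu 0)
  have hδ : 0 ≤ δ := (tsum_nonneg fun _ => norm_nonneg _).trans htail
  have hsum : Summable fun n => γ n * u n := by
    refine Summable.of_norm_bounded (g := fun n => ‖γ n‖ * B) (hγ.norm.mul_right B) fun n => ?_
    rw [norm_mul]
    exact mul_le_mul_of_nonneg_left (hu n) (norm_nonneg _)
  have hγN : Summable fun n => ‖γ (n + N)‖ := (summable_nat_add_iff N).2 hγ.norm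
  have h1 : ‖∑' n, γ (n + N) * u (n + N)‖ ≤ δ * B := by
    refine (tsum_of_norm_bounded (hγN.hasSum.mul_right B) fun n => ?_).trans
      (mul_le_mul_of_nonneg_right htail hB)
    rw [norm_mul]
    exact mul_le_mul_of_nonneg_left (hu _) (norm_nonneg _)
  have h2 : ‖∑ i : Fin N, γ i * (u i - v i)‖ ≤ (∑' n, ‖γ n‖) * δ := by
    calc ‖∑ i : Fin N, γ i * (u i - v i)‖ ≤ ∑ i : Fin N, ‖γ i‖ * δ := by
          refine norm_sum_le_of_le _ fun i _ => ?_
          rw [norm_mul]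
          exact mul_le_mul_of_nonneg_left (hv i) (norm_nonneg _)
      _ = (∑ i ∈ Finset.range N, ‖γ i‖) * δ := by
          rw [← Finset.sum_mul, Fin.sum_univ_eq_sum_range fun i => ‖γ i‖]
      _ ≤ (∑' n, ‖γ n‖) * δ :=
          mul_le_mul_of_nonneg_right (hγ.norm.sum_le_tsum _ fun _ _ => norm_nonneg _) hδ
  have h3 : ∑' n, γ n * u n - ∑ i : Fin N, γ i * v i =
      ∑ i : Fin N, γ i * (u i - v i) + ∑' n, γ (n + N) * u (n + N) := by
    rw [← hsum.sum_add_tsum_nat_add N, ← Fin.sum_univ_eq_sum_range fun i => γ i * u i]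
    simp only [mul_sub, Finset.sum_sub_distrib]
    ring
  rw [h3]
  refine (norm_add_le _ _).trans ((add_le_add h2 h1).trans (le_of_eq ?_))
  ring

/-- A finite corner of an infinite doubly stochastic matrix is a corner of a finite doubly
stochastic matrix, hence of a convex combination of permutation matrices. -/
lemma exists_perm_weights_of_corner {ι : Type*} [Fintype ι] [DecidableEq ι] {p : ι → ι → ℝ}
    (h0 : ∀ i j, 0 ≤ p i j) (hr : ∀ i, ∑ j, p i j ≤ 1) (hc : ∀ j, ∑ i, p i j ≤ 1) :
    ∃ w : Equiv.Perm (ι ⊕ ι) → ℝ, (∀ π, 0 ≤ w π) ∧ ∑ π, w π = 1 ∧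
      ∀ i j, p i j = ∑ π, w π * if π (Sum.inl i) = Sum.inl j then 1 else 0 := by
  -- The diagonal blocks are p and its transpose; the off-diagonal blocks hold the row and column
  -- deficits of p, so all row and column sums are 1.
  let M : Matrix (ι ⊕ ι) (ι ⊕ ι) ℝ := Matrix.fromBlocks (Matrix.of p)
    (Matrix.diagonal fun i => 1 - ∑ j, p i j) (Matrix.diagonal fun j => 1 - ∑ i, p i j)
    (Matrix.of p).transpose
  have hM : M ∈ doublyStochastic ℝ (ι ⊕ ι) := by
    rw [mem_doublyStochastic_iff_sum]
    refine ⟨?_, ?_, ?_⟩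
    · rintro (i | i) (j | j)
      · exact h0 i j
      · simp only [M, Matrix.fromBlocks_apply₁₂, Matrix.diagonal_apply]
        split_ifs
        · exact sub_nonneg.2 (hr i)
        · exact le_rfl
      · simp only [M, Matrix.fromBlocks_apply₂₁, Matrix.diagonal_apply]
        split_ifs
        · exact sub_nonneg.2 (hc i)
        · exact le_rfl
      · exact h0 j i
    · rintro (i | i) <;> simp [M, Fintype.sum_sum_type, Matrix.diagonal_apply]
    · rintro (i | i) <;> simp [M, Fintype.sum_sum_type, Matrix.diagonal_apply]
  obtain ⟨w, hw0, hw1, hw⟩ := exists_eq_sum_perm_of_mem_doublyStochastic hM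
  refine ⟨w, hw0, hw1, fun i j => ?_⟩
  have := congrFun (congrFun hw (Sum.inl i)) (Sum.inl j)
  rw [Matrix.sum_apply] at this
  simpa [M, Equiv.toPEquiv_apply, eq_comm] using this.symm

/-- Averaging `γ` and `τ` against an infinite doubly stochastic matrix gives a point of the closed
convex hull of the values obtained from permutations. -/
theorem tsum_mem_closure_convexHull_cSpectrum {γ τ q : ℕ → ℂ} {p : ℕ → ℕ → ℝ} (hγ : Summable γ)
    (hτ : Filter.Tendsto τ Filter.atTop (nhds 0)) (h0 : ∀ n m, 0 ≤ p n m)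
    (hr : ∀ n, HasSum (p n) 1) (hc : ∀ m, HasSum (fun n => p n m) 1)
    (hq : ∀ n, HasSum (fun m => τ m * p n m) (q n)) :
    ∑' n, γ n * q n ∈ closure (convexHull ℝ (cSpectrum γ τ)) := by
  obtain ⟨B, hB⟩ : ∃ B, ∀ n, ‖τ n‖ ≤ B := by
    obtain ⟨B, hB⟩ := hτ.norm.bddAbove_range
    exact ⟨B, fun n => hB ⟨n, rfl⟩⟩
  have hqB : ∀ n, ‖q n‖ ≤ B := fun n => by
    have h := (hr n).mul_left B
    rw [mul_one] at h
    rw [← (hq n).tsum_eq]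
    refine tsum_of_norm_bounded h fun m => ?_
    rw [norm_mul, Complex.norm_real, Real.norm_of_nonneg (h0 n m)]
    exact mul_le_mul_of_nonneg_right (hB m) (h0 n m)
  set A := ∑' n, ‖γ n‖ with hA
  have hA0 : 0 ≤ A := tsum_nonneg fun _ => norm_nonneg _
  have hB0 : 0 ≤ B := (norm_nonneg _).trans (hB 0)
  rw [Metric.mem_closure_iff]
  intro ε hε
  -- Two errors of size (A + B) δ will occur; the + 1 in the denominator covers A + B = 0.
  obtain ⟨δ, hδ, hδε⟩ : ∃ δ > 0, 2 * ((A + B) * δ) < ε := by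
    refine ⟨ε / (2 * (A + B) + 1), by positivity, ?_⟩
    rw [← mul_assoc, mul_div_assoc', div_lt_iff₀ (by positivity)]
    nlinarith
  obtain ⟨N, hN1, hN2⟩ : ∃ N, ∑' n, ‖γ (n + N)‖ ≤ δ ∧ ∀ m ≥ N, ‖τ m‖ ≤ δ := by
    have e1 := (tendsto_sum_nat_add fun n => ‖γ n‖).eventually_le_const hδ
    have e2 := (tendsto_zero_iff_norm_tendsto_zero.1 hτ).eventually_le_const hδ
    obtain ⟨N2, hN2⟩ := Filter.eventually_atTop.1 e2
    obtain ⟨N, hN, hN'⟩ := (e1.and (Filter.eventually_ge_atTop N2)).exists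
    exact ⟨N, hN, fun m hm => hN2 m (hN'.trans hm)⟩
  obtain ⟨w, hw0, hw1, hw⟩ := exists_perm_weights_of_corner (p := fun i j : Fin N => p i j)
    (fun i j => h0 i j)
    (fun i => by
      rw [Fin.sum_univ_eq_sum_range fun j => p i j]
      exact sum_le_hasSum _ (fun j _ => h0 i j) (hr i))
    (fun j => by
      rw [Fin.sum_univ_eq_sum_range fun i => p i j]
      exact sum_le_hasSum _ (fun i _ => h0 i j) (hc j))
  -- The first copy becomes 0, …, N - 1 and the second N, …, 2N - 1; permutations extend by the
  -- identity outside this range.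
  let e : Fin N ⊕ Fin N ↪ ℕ := finSumFinEquiv.toEmbedding.trans Fin.valEmbedding
  have el : ∀ i, e (Sum.inl i) = i := fun i => rfl
  have er : ∀ i, e (Sum.inr i) = N + i := fun i => rfl
  let S : Equiv.Perm (Fin N ⊕ Fin N) → ℂ := fun π => ∑' n, γ n * τ (π.viaEmbedding e n)
  -- Indices sent into the second copy land at positions ≥ N, where ‖τ‖ ≤ δ, so replacing that value
  -- by 0 costs at most δ.
  let a : Equiv.Perm (Fin N ⊕ Fin N) → Fin N → ℂ := fun π i =>
    ∑ j : Fin N, if π (Sum.inl i) = Sum.inl j then τ j else 0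
  have hS : ∀ π, ‖S π - ∑ i : Fin N, γ i * a π i‖ ≤ (A + B) * δ := fun π => by
    refine norm_tsum_mul_sub_sum_le hγ (fun n => hB _) (fun i => ?_) hN1
    have h1 : π.viaEmbedding e i = e (π (Sum.inl i)) := by
      rw [← el, Equiv.Perm.viaEmbedding_apply]
    rw [h1]
    simp only [a]
    rcases π (Sum.inl i) with j | j
    · simpa [el] using hδ.le
    · simpa [er] using hN2 (N + j) (Nat.le_add_right _ _)
  refine ⟨∑ π, w π • S π, mem_convexHull_of_exists_fintype w S hw0 hw1
    (fun π => ⟨π.viaEmbedding e, rfl⟩) rfl, ?_⟩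
  set Z : ℂ := ∑ i : Fin N, γ i * ∑ j : Fin N, τ j * p i j with hZ
  have hz1 : ‖∑' n, γ n * q n - Z‖ ≤ (A + B) * δ := by
    refine norm_tsum_mul_sub_sum_le hγ hqB (fun i => ?_) hN1
    have h1 := (hasSum_nat_add_iff' N).2 (hq i)
    rw [← Fin.sum_univ_eq_sum_range fun j => τ j * p i j] at h1
    have h2 := ((summable_nat_add_iff N).2 (hr i).summable).hasSum.mul_left δ
    rw [← h1.tsum_eq]
    refine (tsum_of_norm_bounded h2 fun m => ?_).trans ?_
    · rw [norm_mul, Complex.norm_real, Real.norm_of_nonneg (h0 _ _)]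
      exact mul_le_mul_of_nonneg_right (hN2 _ (Nat.le_add_left _ _)) (h0 _ _)
    · have h3 := (hr i).summable.sum_add_tsum_nat_add N
      rw [(hr i).tsum_eq] at h3
      have h4 := Finset.sum_nonneg fun j (_ : j ∈ Finset.range N) => h0 i j
      nlinarith
  have hZw : Z = ∑ π, w π • ∑ i : Fin N, γ i * a π i := by
    have : ∀ i : Fin N, ∑ j : Fin N, τ j * p i j = ∑ π, w π • a π i := fun i => by
      simp only [hw, a, Finset.smul_sum]
      rw [Finset.sum_comm]
      refine Finset.sum_congr rfl fun j _ => ?_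
      rw [Complex.ofReal_sum, Finset.mul_sum]
      refine Finset.sum_congr rfl fun π _ => ?_
      split_ifs <;> simp [mul_comm]
    simp only [hZ, this, Finset.mul_sum, Finset.smul_sum]
    rw [Finset.sum_comm]
    refine Finset.sum_congr rfl fun π _ => Finset.sum_congr rfl fun i _ => ?_
    rw [mul_smul_comm]
  have hz2 : ‖Z - ∑ π, w π • S π‖ ≤ (A + B) * δ := by
    rw [hZw, ← Finset.sum_sub_distrib]
    calc _ ≤ ∑ π, w π * ((A + B) * δ) := by
          refine norm_sum_le_of_le _ fun π _ => ?_
          rw [← smul_sub, norm_smul, Real.norm_of_nonneg (hw0 π), norm_sub_rev]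
          exact mul_le_mul_of_nonneg_left (hS π) (hw0 π)
      _ = (A + B) * δ := by rw [← Finset.sum_mul, hw1, one_mul]
  rw [dist_eq_norm]
  calc _ ≤ ‖∑' n, γ n * q n - Z‖ + ‖Z - ∑ π, w π • S π‖ := norm_sub_le_norm_sub_add_norm_sub _ _ _
    _ < ε := by linarith

/-- The closed convex hull of a bounded set lies in the convex hull of its closure. -/
lemma closure_convexHull_subset {E : Type*} [NormedAddCommGroup E] [NormedSpace ℝ E]
    [FiniteDimensional ℝ E] {s : Set E} (hs : Bornology.IsBounded s) :
    closure (convexHull ℝ s) ⊆ convexHull ℝ (closure s) := by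
  have : ProperSpace E := FiniteDimensional.proper ℝ E
  exact closure_minimal (convexHull_mono subset_closure)
    (isCompact_convexHull_of_isCompact hs.isCompact_closure).isClosed

/-! ### Traces in eigenbases and the two inclusions -/

omit [CompleteSpace H] in
/-- **Parseval's identity**. -/
lemma hasSum_norm_inner_sq {ι : Type*} (b : HilbertBasis ι ℂ H) (x : H) :
    HasSum (fun i => ‖⟪b i, x⟫_ℂ‖ ^ 2) (‖x‖ ^ 2) := by
  have h := Complex.hasSum_re (b.hasSum_inner_mul_inner x x)
  convert h using 1
  · funext i
    rw [← inner_conj_symm x (b i), ← Complex.normSq_eq_conj_mul_self, Complex.ofReal_re,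
      Complex.normSq_eq_norm_sq]
  · rw [inner_self_eq_norm_sq_to_K]
    norm_cast

omit [CompleteSpace H] in
lemma tendsto_eigenvalues_zero {T : H →L[ℂ] H} (hTc : IsCompactOperator T)
    {b : HilbertBasis ℕ ℂ H} {τ : ℕ → ℂ} (hτ : ∀ n, T (b n) = τ n • b n) :
    Filter.Tendsto τ Filter.atTop (nhds 0) := by
  rw [← Nat.cofinite_eq_atTop, Metric.tendsto_nhds]
  intro ε hε
  rw [Filter.eventually_cofinite]
  simpa using finite_setOf_le_norm_eigenvalue hTc b.orthonormal hτ hε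

/-- The trace of `C B` in terms of an orthonormal basis of eigenvectors of `C`. -/
lemma hasSum_trace_eigenvectors {C : H →L[ℂ] H} (hC : IsTraceClass C) (hCn : IsStarNormal C)
    {b : HilbertBasis ℕ ℂ H} {γ : ℕ → ℂ} (hγ : ∀ n, C (b n) = γ n • b n) (B : H →L[ℂ] H) :
    HasSum (fun n => γ n * ⟪b n, B (b n)⟫_ℂ) (trace (C * B)) := by
  convert hC.hasSum_trace B b using 1
  funext n
  exact (inner_apply_eigenvector hCn hγ n _).symm

/-- The series is that of the trace of C · 1 in the eigenbasis. -/
lemma summable_eigenvalues {C : H →L[ℂ] H} (hC : IsTraceClass C) (hCn : IsStarNormal C)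
    {b : HilbertBasis ℕ ℂ H} {γ : ℕ → ℂ} (hγ : ∀ n, C (b n) = γ n • b n) : Summable γ := by
  convert (hasSum_trace_eigenvectors hC hCn hγ 1).summable using 1
  funext n
  simp [inner_self_eq_norm_sq_to_K, b.orthonormal.1]

lemma exists_unitary_apply_eq {ι : Type*} (b c : HilbertBasis ι ℂ H) :
    ∃ U ∈ unitary (H →L[ℂ] H), ∀ i, U (b i) = c i := by
  classical
  let V : H ≃ₗᵢ[ℂ] H := b.repr.trans c.repr.symm
  refine ⟨_, (Unitary.linearIsometryEquiv.symm V).2, fun i => ?_⟩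
  change c.repr.symm (b.repr (b i)) = c i
  rw [b.repr_self, c.repr_symm_single]

lemma inner_star_mul_mul_apply (U T : H →L[ℂ] H) (x : H) :
    ⟪x, (star U * T * U) x⟫_ℂ = ⟪U x, T (U x)⟫_ℂ :=
  ContinuousLinearMap.adjoint_inner_right U x (T (U x))

section

variable {C T : H →L[ℂ] H} {b c : HilbertBasis ℕ ℂ H} {γ τ : ℕ → ℂ}

lemma cSpectrum_subset_cNumericalRange (hC : IsTraceClass C) (hCn : IsStarNormal C)
    (hγ : ∀ n, C (b n) = γ n • b n) (hτ : ∀ n, T (c n) = τ n • c n) :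
    cSpectrum γ τ ⊆ cNumericalRange C T := by
  rintro _ ⟨σ, rfl⟩
  obtain ⟨d, hd⟩ := exists_hilbertBasis_reindex c σ
  obtain ⟨U, hU, hUb⟩ := exists_unitary_apply_eq b d
  refine ⟨U, hU, ?_⟩
  rw [← (hasSum_trace_eigenvectors hC hCn hγ (star U * T * U)).tsum_eq]
  refine tsum_congr fun n => ?_
  rw [inner_star_mul_mul_apply, hUb, hd, hτ, inner_smul_right, inner_self_eq_norm_sq_to_K,
    c.orthonormal.1]
  simp

lemma cNumericalRange_subset_closure (hC : IsTraceClass C) (hCn : IsStarNormal C)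
    (hTc : IsCompactOperator T) (hTn : IsStarNormal T)
    (hγ : ∀ n, C (b n) = γ n • b n) (hτ : ∀ n, T (c n) = τ n • c n) :
    cNumericalRange C T ⊆ closure (convexHull ℝ (cSpectrum γ τ)) := by
  rintro _ ⟨U, hU, rfl⟩
  rw [← (hasSum_trace_eigenvectors hC hCn hγ (star U * T * U)).tsum_eq]
  simp only [inner_star_mul_mul_apply]
  -- Rows sum to ‖U bₙ‖² = 1 and columns to ‖U† cₘ‖² = 1; expanding ⟪U bₙ, T U bₙ⟫ in the basis c
  -- gives the weighted means of τ.
  refine tsum_mem_closure_convexHull_cSpectrum (p := fun n m => ‖⟪c m, U (b n)⟫_ℂ‖ ^ 2)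
    (summable_eigenvalues hC hCn hγ) (tendsto_eigenvalues_zero hTc hτ) (fun n m => by positivity)
    (fun n => ?_) (fun m => ?_) fun n => ?_
  · have h := hasSum_norm_inner_sq c (U (b n))
    rwa [ContinuousLinearMap.norm_map_of_mem_unitary hU, b.orthonormal.1, one_pow] at h
  · have h := hasSum_norm_inner_sq b (star U (c m))
    rw [ContinuousLinearMap.norm_map_of_mem_unitary (Unitary.star_mem hU), c.orthonormal.1,
      one_pow] at h
    convert h using 2 with n
    rw [ContinuousLinearMap.star_eq_adjoint, ContinuousLinearMap.adjoint_inner_right,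
      norm_inner_symm]
  · have h : ∀ m, τ m * ((‖⟪c m, U (b n)⟫_ℂ‖ ^ 2 : ℝ) : ℂ) =
        ⟪U (b n), c m⟫_ℂ * ⟪c m, T (U (b n))⟫_ℂ := fun m => by
      rw [inner_apply_eigenvector hTn hτ, ← inner_conj_symm (U (b n)) (c m), mul_left_comm,
        ← Complex.normSq_eq_conj_mul_self, Complex.normSq_eq_norm_sq]
    simp only [h]
    exact c.hasSum_inner_mul_inner (U (b n)) (T (U (b n)))

end

lemma summable_mul_of_tendsto_zero {γ τ : ℕ → ℂ} (hγ : Summable γ)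
    (hτ : Filter.Tendsto τ Filter.atTop (nhds 0)) (σ : ℕ → ℕ) :
    Summable fun n => γ n * τ (σ n) := by
  obtain ⟨B, hB⟩ := hτ.norm.bddAbove_range
  refine Summable.of_norm_bounded (hγ.norm.mul_right B) fun n => ?_
  rw [norm_mul]
  exact mul_le_mul_of_nonneg_left (hB ⟨σ n, rfl⟩) (norm_nonneg _)

lemma isBounded_cSpectrum {γ τ : ℕ → ℂ} (hγ : Summable γ)
    (hτ : Filter.Tendsto τ Filter.atTop (nhds 0)) : Bornology.IsBounded (cSpectrum γ τ) := by
  obtain ⟨B, hB⟩ := hτ.norm.bddAbove_range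
  refine isBounded_iff_forall_norm_le.2 ⟨(∑' n, ‖γ n‖) * B, ?_⟩
  rintro _ ⟨σ, rfl⟩
  refine tsum_of_norm_bounded (hγ.norm.hasSum.mul_right B) fun n => ?_
  rw [norm_mul]
  exact mul_le_mul_of_nonneg_left (hB ⟨σ n, rfl⟩) (norm_nonneg _)

end CNumRange

end

theorem theorem3p3 {H : Type*} [NormedAddCommGroup H] [InnerProductSpace ℂ H] [CompleteSpace H]
    [TopologicalSpace.SeparableSpace H] (hH : ¬ FiniteDimensional ℂ H)
    (C T : H →L[ℂ] H) (hC : CNumRange.IsTraceClass C) (hT : IsCompactOperator T)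
    (hCn : IsStarNormal C) (hTn : IsStarNormal T) :
    (∃ γ, CNumRange.IsModifiedEigenvalueSeq C γ) ∧
    (∃ τ, CNumRange.IsModifiedEigenvalueSeq T τ) ∧
    ∀ γ τ : ℕ → ℂ, CNumRange.IsModifiedEigenvalueSeq C γ →
      CNumRange.IsModifiedEigenvalueSeq T τ →
        (∀ σ : Equiv.Perm ℕ, Summable fun n => γ n * τ (σ n)) ∧
        CNumRange.cSpectrum γ τ ⊆ CNumRange.cNumericalRange C T ∧
        CNumRange.cNumericalRange C T ⊆ convexHull ℝ (closure (CNumRange.cSpectrum γ τ)) := by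
  refine ⟨CNumRange.exists_isModifiedEigenvalueSeq hH hC.1 hCn,
    CNumRange.exists_isModifiedEigenvalueSeq hH hT hTn, fun γ τ hγ hτ => ?_⟩
  obtain ⟨b, hb⟩ := hγ.exists_hilbertBasis hH hC.1 hCn
  obtain ⟨c, hc⟩ := hτ.exists_hilbertBasis hH hT hTn
  have hγs := CNumRange.summable_eigenvalues hC hCn hb
  have hτ0 := CNumRange.tendsto_eigenvalues_zero hT hc
  exact ⟨fun σ => CNumRange.summable_mul_of_tendsto_zero hγs hτ0 σ,
    CNumRange.cSpectrum_subset_cNumericalRange hC hCn hb hc,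
    (CNumRange.cNumericalRange_subset_closure hC hCn hT hTn hb hc).trans
      (CNumRange.closure_convexHull_subset (CNumRange.isBounded_cSpectrum hγs hτ0))⟩
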